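/- Let $\tau = e^{2\pi i/3}$, $\mathbb{Z}[\tau] = \{a + b\tau : a,b \in \mathbb{Z}\}$, $E = \mathbb{C}/\mathbb{Z}[\tau]$, and let $\mathbb{P}^1_{3,3,3} = [E/\mathbb{Z}_3]$ be the global quotient orbifold by the rotation group generated by multiplication by $\tau$, with orbifold universal covering $p : \mathbb{C} \to E \to \mathbb{P}^1_{3,3,3}$. Its three cone points, which serve both as the marked points $z_1, z_2, z_3$ of the domain and as the cone points $w_1, w_2, w_3$ of the target, are the images under $p$ of $0$, $\frac{1+2\tau}{3}$, $\frac{2+\tau}{3}$. A holomorphic orbi-sphere $u : \mathbb{P}^1_{3,3,3} \to \mathbb{P}^1_{3,3,3}$ is a continuous map of underlying spaces which around every point has a holomorphic lifting to local uniformizing charts, equivariant with respect to an injective homomorphism of isotropy groups. It contributes to $\langle \Delta_{j_1}^{1/3}, \Delta_{j_2}^{1/3}, \Delta_{j_3}^{1/3} \rangle_{0,3}$ if for $i = 1,2,3$ we have $u(z_i) = w_{j_i}$ and the homomorphism of isotropy groups at $z_i$ sends the generator acting on the tangent line by $e^{2\pi i/3}$ to an element of age $\frac13$, that is, one acting on the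 tangent line at $w_{j_i}$ by $e^{2\pi i/3}$. **Proposition.** Let $u : \mathbb{P}^1_{3,3,3} \to \mathbb{P}^1_{3,3,3}$ be a non-constant holomorphic orbi-sphere contributing to $\langle \Delta_1^{1/3}, \Delta_j^{1/3}, \Delta_k^{1/3} \rangle_{0,3}$ for some $j,k \in \{1,2,3\}$. Then $u$ has a lifting to the universal covers preserving the base point $0$, i.e. a continuous map $\tilde u : \mathbb{C} \to \mathbb{C}$ with $p \circ \tilde u = u \circ p$ and $\tilde u(0) = 0$; and every such $\tilde u$ is of the form $\tilde u(z) = \lambda z$ for all $z \in \mathbb{C}$, for some $\lambda \in \mathbb{Z}[\tau]$. -/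

import Mathlib

noncomputable section

namespace OrbiSphere

/-- `τ = exp(2πi/3)`. -/
def tau : ℂ := Complex.exp (2 * Real.pi * Complex.I / 3)

theorem tau_pow_three : tau ^ 3 = 1 := by
  rw [tau, ← Complex.exp_nat_mul, ← Complex.exp_two_pi_mul_I]
  congr 1
  push_cast
  ring

theorem tau_ne_one : tau ≠ 1 := by
  intro h
  rw [tau, Complex.exp_eq_one_iff] at h
  obtain ⟨n, hn⟩ := h
  have h3 : (2 * Real.pi * Complex.I : ℂ) ≠ 0 := Complex.two_pi_I_ne_zero
  have h1 : (2 * Real.pi * Complex.I : ℂ) * (3 * n - 1) = 0 := by linear_combination (-3) * hn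
  rcases mul_eq_zero.1 h1 with h | h
  · exact h3 h
  · have : (3 * n - 1 : ℤ) = 0 := by exact_mod_cast h
    omega

theorem tau_sq : tau ^ 2 = -tau - 1 := by
  have h : (tau - 1) * (tau ^ 2 + tau + 1) = 0 := by linear_combination tau_pow_three
  rcases mul_eq_zero.1 h with h | h
  · exact absurd (sub_eq_zero.1 h) tau_ne_one
  · linear_combination h

theorem eq_of_pow_three {ζ : ℂ} (h : ζ ^ 3 = 1) : ζ = 1 ∨ ζ = tau ∨ ζ = -tau - 1 := by
  have h1 : (ζ - 1) * ((ζ - tau) * (ζ - (-tau - 1))) = 0 := by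
    linear_combination h - (ζ - 1) * tau_sq
  rcases mul_eq_zero.1 h1 with h | h
  · exact Or.inl (sub_eq_zero.1 h)
  rcases mul_eq_zero.1 h with h | h
  · exact Or.inr (Or.inl (sub_eq_zero.1 h))
  · exact Or.inr (Or.inr (sub_eq_zero.1 h))

/-- The lattice `ℤ[τ] = {a + b τ | a, b ∈ ℤ}` in `ℂ`. -/
def zTau : AddSubgroup ℂ where
  carrier := {z | ∃ a b : ℤ, z = a + b * tau}
  zero_mem' := ⟨0, 0, by simp⟩
  add_mem' := by
    rintro _ _ ⟨a, b, rfl⟩ ⟨c, d, rfl⟩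
    exact ⟨a + c, b + d, by push_cast; ring⟩
  neg_mem' := by
    rintro _ ⟨a, b, rfl⟩
    exact ⟨-a, -b, by push_cast; ring⟩

theorem tau_mul_mem {l : ℂ} (hl : l ∈ zTau) : tau * l ∈ zTau := by
  obtain ⟨a, b, rfl⟩ := hl
  exact ⟨-b, a - b, by push_cast; linear_combination (b : ℂ) * tau_sq⟩

theorem mul_mem_of_pow_three {ζ l : ℂ} (h : ζ ^ 3 = 1) (hl : l ∈ zTau) : ζ * l ∈ zTau := by
  rcases eq_of_pow_three h with rfl | rfl | rfl
  · simpa using hl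
  · exact tau_mul_mem hl
  · have := zTau.sub_mem (zTau.neg_mem (tau_mul_mem hl)) hl
    convert this using 1
    ring

/-! ### The underlying space of the orbifold `[E / ℤ₃]` and the projection from `ℂ` -/

/-- The elliptic curve `E = ℂ / ℤ⟨1, τ⟩`. -/
abbrev E : Type := ℂ ⧸ zTau

/-- Multiplication by a cube root of unity, descended to `E`. -/
def rot (ζ : rootsOfUnity 3 ℂ) : E →+ E :=
  QuotientAddGroup.map zTau zTau (AddMonoidHom.mulLeft ((ζ : ℂˣ) : ℂ)) fun _ hl =>
    mul_mem_of_pow_three (by exact_mod_cast (mem_rootsOfUnity' 3 (ζ : ℂˣ)).1 ζ.2) hl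

/-- The action of `ℤ₃` (realised as the group of cube roots of unity) on `E` by rotations. -/
instance rotAction : MulAction (rootsOfUnity 3 ℂ) E where
  smul ζ e := rot ζ e
  one_smul e := by
    induction e using QuotientAddGroup.induction_on with
    | H z => exact congrArg (QuotientAddGroup.mk (s := zTau)) (by simp)
  mul_smul ζ η e := by
    induction e using QuotientAddGroup.induction_on with
    | H z => exact congrArg (QuotientAddGroup.mk (s := zTau)) (by simp [mul_assoc])

/-- The underlying topological space `|P¹₃,₃,₃| = E / ℤ₃`, with the quotient topology. -/
abbrev P333 : Type := MulAction.orbitRel.Quotient (rootsOfUnity 3 ℂ) E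

/-- The orbifold universal covering `p : ℂ → E → E / ℤ₃`. -/
def p (z : ℂ) : P333 := Quotient.mk'' (QuotientAddGroup.mk (s := zTau) z)

/-- The group of deck transformations of `p`: all maps `z ↦ ζ z + l` with `ζ³ = 1` and
`l ∈ ℤ[τ]`. It acts on `ℂ` by evaluation. -/
def deckGroup : Subgroup (Equiv.Perm ℂ) where
  carrier := {σ | ∃ ζ : ℂ, ζ ^ 3 = 1 ∧ ∃ l ∈ zTau, ∀ z, σ z = ζ * z + l}
  one_mem' := ⟨1, by simp, 0, zTau.zero_mem, by simp⟩
  mul_mem' := by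
    rintro σ ρ ⟨ζ, hζ, l, hl, h⟩ ⟨η, hη, m, hm, h'⟩
    refine ⟨ζ * η, by rw [mul_pow, hζ, hη, one_mul], ζ * m + l,
      zTau.add_mem (mul_mem_of_pow_three hζ hm) hl, fun z => ?_⟩
    rw [Equiv.Perm.mul_apply, h, h']
    ring
  inv_mem' := by
    rintro σ ⟨ζ, hζ, l, hl, h⟩
    have hζ2 : (ζ ^ 2) ^ 3 = 1 := by linear_combination (ζ ^ 3 + 1) * hζ
    refine ⟨ζ ^ 2, hζ2, -(ζ ^ 2 * l), zTau.neg_mem (mul_mem_of_pow_three hζ2 hl), fun z => ?_⟩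
    rw [Equiv.Perm.inv_eq_iff_eq, h]
    linear_combination (l - z) * hζ

/-- Two points of `ℂ` have the same image in `P¹₃,₃,₃` exactly if they differ by a deck
transformation, so that `P¹₃,₃,₃` is the quotient of `ℂ` by `deckGroup`. -/
theorem p_eq_iff (z w : ℂ) : p z = p w ↔ ∃ g : deckGroup, g • z = w := by
  constructor
  · intro h
    obtain ⟨ζ, hζ⟩ : ∃ ζ : rootsOfUnity 3 ℂ,
        rot ζ (QuotientAddGroup.mk (s := zTau) w) = QuotientAddGroup.mk (s := zTau) z :=
      MulAction.orbitRel_apply.1 (Quotient.exact h)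
    have h3 : ((ζ : ℂˣ) : ℂ) ^ 3 = 1 := by
      exact_mod_cast (mem_rootsOfUnity' 3 (ζ : ℂˣ)).1 ζ.2
    have hl : -(((ζ : ℂˣ) : ℂ) * w) + z ∈ zTau := QuotientAddGroup.eq.1 hζ
    generalize ((ζ : ℂˣ) : ℂ) = c at h3 hl
    have hc : c ≠ 0 := by rintro rfl; norm_num at h3
    let g : Equiv.Perm ℂ :=
      { toFun := fun x => c * x + (-(c * w) + z)
        invFun := fun x => c⁻¹ * (x - (-(c * w) + z))
        left_inv := fun x => by field_simp; ring
        right_inv := fun x => by field_simp; ring }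
    have hg : g ∈ deckGroup := ⟨c, h3, _, hl, fun _ => rfl⟩
    refine ⟨(⟨g, hg⟩ : deckGroup)⁻¹, ?_⟩
    rw [inv_smul_eq_iff]
    change z = c * w + (-(c * w) + z)
    ring
  · rintro ⟨⟨g, ζ, hζ, l, hl, h⟩, rfl⟩
    refine (Quotient.sound (MulAction.orbitRel_apply.2 ?_)).symm
    have hu : (Units.mk0 ζ (by rintro rfl; norm_num at hζ)) ^ 3 = 1 := by
      ext; simpa using hζ
    refine ⟨⟨_, (mem_rootsOfUnity 3 _).2 hu⟩, ?_⟩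
    refine QuotientAddGroup.eq.2 ?_
    change -(ζ * z) + g z ∈ zTau
    rw [h]
    simpa using hl

/-! ### Orbifold charts and holomorphic maps of orbifolds -/

/-- The isotropy group at `x̃ ∈ ℂ`: the deck transformations fixing `x̃`. -/
abbrev isotropy (x : ℂ) : Subgroup deckGroup := MulAction.stabilizer deckGroup x

/-- A local uniformizing chart of `P¹₃,₃,₃` around `p x̃`: an open set `V ∋ x̃` in `ℂ` on which the
isotropy group `G` of `x̃` acts, such that two points of `V` have the same image in `P¹₃,₃,₃` only
if they lie in the same `G`-orbit; thus `p` identifies `V / G` with an open subset of `P¹₃,₃,₃`,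
and `x̃`, the only point of `V` over `p x̃`, is fixed by `G`. -/
structure UniformizingChart (x : ℂ) where
  V : Set ℂ
  isOpen : IsOpen V
  mem : x ∈ V
  smul_mem : ∀ g ∈ isotropy x, ∀ v ∈ V, g • v ∈ V
  mem_isotropy : ∀ g : deckGroup, ∀ v ∈ V, g • v ∈ V → g ∈ isotropy x

/-- A local holomorphic lifting of `u : P¹₃,₃,₃ → P¹₃,₃,₃` with respect to uniformizing charts
`(V, G)` around `p x̃` and `(W, H)` around `p ỹ`, equivariant with respect to an injective group
homomorphism `G → H`. -/
structure LocalLifting (u : P333 → P333) (x y : ℂ) where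
  dom : UniformizingChart x
  cod : UniformizingChart y
  /-- only its restriction to `dom.V` matters -/
  toFun : ℂ → ℂ
  mapsTo : Set.MapsTo toFun dom.V cod.V
  holomorphic : DifferentiableOn ℂ toFun dom.V
  lifts : ∀ v ∈ dom.V, p (toFun v) = u (p v)
  hom : isotropy x →* isotropy y
  hom_injective : Function.Injective hom
  equivariant : ∀ g : isotropy x, ∀ v ∈ dom.V, toFun (g • v) = hom g • toFun v

/-- `u` is a holomorphic map of orbifolds: it is continuous and, around every point, it has a
holomorphic local lifting to uniformizing charts that is equivariant with respect to an injective
homomorphism of isotropy groups. -/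
def IsHolomorphicOrbiMap (u : P333 → P333) : Prop :=
  Continuous u ∧ ∀ a : P333, ∃ x y : ℂ, p x = a ∧ p y = u a ∧ Nonempty (LocalLifting u x y)

/-- An element `h` of the isotropy group at `ỹ` has age `ι ∈ [0, 1)` if it acts on the tangent
line at `ỹ` as multiplication by `exp(2πi ι)`. -/
def HasAge {y : ℂ} (h : isotropy y) (ι : ℚ) : Prop :=
  0 ≤ ι ∧ ι < 1 ∧
    HasDerivAt (fun w : ℂ => h • w) (Complex.exp (2 * Real.pi * Complex.I * (ι : ℂ))) y

/-- Lifts to `ℂ` of the three cone points. -/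
def coneLift : Fin 3 → ℂ := ![0, (1 + 2 * tau) / 3, (2 + tau) / 3]

/-- The three cone points, numbered by `0, 1, 2` instead of `1, 2, 3`. They are the marked points
`z₁, z₂, z₃` of the domain as well as the cone points `w₁, w₂, w₃` of the target. -/
def conePoint (i : Fin 3) : P333 := p (coneLift i)

/-- The orbi-insertion of `u` at the marked point `z_i` is `Δ_j^ι`: `u` sends `z_i` to `w_j`, and
the homomorphism of isotropy groups sends the generator acting on the tangent line at `z_i` by
`exp(2πi/3)` to an element of age `ι`. -/
def HasInsertion (u : P333 → P333) (i j : Fin 3) (ι : ℚ) : Prop :=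
  ∃ x y : ℂ, p x = conePoint i ∧ p y = conePoint j ∧ u (conePoint i) = conePoint j ∧
    ∃ F : LocalLifting u x y, ∃ g : isotropy x, HasAge g (1 / 3) ∧ HasAge (F.hom g) ι

/-- `u : P¹₃,₃,₃ → P¹₃,₃,₃` is a holomorphic orbi-sphere contributing to
`⟨Δ_{j 0}^{1/3}, Δ_{j 1}^{1/3}, Δ_{j 2}^{1/3}⟩`. -/
def ContributesTo (u : P333 → P333) (j : Fin 3 → Fin 3) : Prop :=
  IsHolomorphicOrbiMap u ∧ ∀ i : Fin 3, HasInsertion u i (j i) (1 / 3)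

/-- `f : ℂ → ℂ` is a lifting of `u` to the orbifold universal covers. -/
def IsLifting (u : P333 → P333) (f : ℂ → ℂ) : Prop :=
  Continuous f ∧ ∀ z : ℂ, p (f z) = u (p z)

end OrbiSphere

end

/-! Two local holomorphic lifts of `u` differ by a deck map `z ↦ ζ z + l` with `ζ³ = 1`
(`exists_deck_of_eventually_p_eq`), so the cube of the derivative is independent of the lift. It
defines an entire `ℤ[τ]`-periodic function, constant by Liouville; hence every local lift is affine,
and one of them extends to a global lift `a z + b` by a clopen argument (`exists_affine_lift`).
Since `u` fixes `p 0`, `b` lies in `ℤ[τ]` and can be dropped; then `p a = u (p 1) = u (p 0) = p 0`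
puts `a` in `ℤ[τ]`. A lift that is merely continuous is still a deck map applied to `a z`
(`exists_deck_of_p_eq_p_mul`), which leaves `ζ a z` once `0` is fixed. -/

open Filter Topology Set Metric

namespace OrbiSphere

/-! ### The lattice `ℤ[τ]` and the deck group -/

theorem tau_im_ne_zero : tau.im ≠ 0 := by
  intro h
  have h2 := congrArg Complex.re tau_sq
  simp only [pow_two, Complex.mul_re, Complex.sub_re, Complex.neg_re, Complex.one_re, h] at h2
  nlinarith [sq_nonneg (tau.re + 1 / 2)]

theorem tau_normSq : tau.re ^ 2 + tau.im ^ 2 = 1 ∧ tau.re = -1 / 2 := by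
  have h1 := congrArg Complex.re tau_sq
  have h2 := congrArg Complex.im tau_sq
  simp only [pow_two, Complex.mul_re, Complex.mul_im, Complex.sub_re, Complex.neg_re,
    Complex.one_re, Complex.sub_im, Complex.neg_im, Complex.one_im] at h1 h2
  have h3 : tau.re = -1 / 2 := by
    have : tau.im * (2 * tau.re + 1) = 0 := by linarith
    rcases mul_eq_zero.1 this with h | h
    · exact absurd h tau_im_ne_zero
    · linarith
  refine ⟨?_, h3⟩
  rw [h3] at h1 ⊢
  nlinarith

/-- The squared norm of `a + b τ` is the integer `a² - a b + b²`. -/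
theorem one_le_norm_of_mem_zTau {l : ℂ} (hl : l ∈ zTau) (h0 : l ≠ 0) : 1 ≤ ‖l‖ := by
  obtain ⟨a, b, rfl⟩ := hl
  obtain ⟨h1, h2⟩ := tau_normSq
  have hn : ‖(a + b * tau : ℂ)‖ ^ 2 = ((a ^ 2 - a * b + b ^ 2 : ℤ) : ℝ) := by
    rw [Complex.sq_norm, Complex.normSq_apply]
    simp only [Complex.add_re, Complex.add_im, Complex.mul_re, Complex.mul_im,
      Complex.intCast_re, Complex.intCast_im]
    push_cast
    linear_combination (b : ℝ) ^ 2 * h1 + 2 * (a : ℝ) * b * h2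
  have hpos : (0 : ℝ) < ((a ^ 2 - a * b + b ^ 2 : ℤ) : ℝ) := by
    rw [← hn]; positivity
  have h1 : (1 : ℝ) ≤ ((a ^ 2 - a * b + b ^ 2 : ℤ) : ℝ) := by
    have : (0 : ℤ) < a ^ 2 - a * b + b ^ 2 := by exact_mod_cast hpos
    exact_mod_cast this
  rw [← hn] at h1
  nlinarith [norm_nonneg (a + b * tau : ℂ)]

instance : DiscreteTopology zTau := by
  refine discreteTopology_of_isOpen_singleton_zero ?_
  rw [Metric.isOpen_singleton_iff]
  refine ⟨1, one_pos, fun y hy => ?_⟩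
  by_contra h
  have h1 : ‖(y : ℂ)‖ < 1 := by simpa [dist_eq_norm] using hy
  exact absurd h1 (not_lt.2 (one_le_norm_of_mem_zTau y.2 fun h' => h (Subtype.ext h')))

theorem isClosed_zTau : IsClosed (zTau : Set ℂ) :=
  AddSubgroup.isClosed_of_discrete

theorem countable_zTau : (zTau : Set ℂ).Countable := by
  refine (countable_range fun q : ℤ × ℤ => (q.1 + q.2 * tau : ℂ)).mono ?_
  rintro _ ⟨a, b, rfl⟩
  exact ⟨(a, b), rfl⟩

theorem countable_cubeRoots : {ζ : ℂ | ζ ^ 3 = 1}.Countable := by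
  refine (Set.toFinite {1, tau, -tau - 1}).countable.mono fun ζ hζ => ?_
  simpa using eq_of_pow_three hζ

theorem p_eq_p_iff (z w : ℂ) :
    p z = p w ↔ ∃ ζ : ℂ, ζ ^ 3 = 1 ∧ ∃ l ∈ zTau, w = ζ * z + l := by
  rw [p_eq_iff]
  constructor
  · rintro ⟨⟨g, ζ, hζ, l, hl, h⟩, rfl⟩
    exact ⟨ζ, hζ, l, hl, h z⟩
  · rintro ⟨ζ, hζ, l, hl, rfl⟩
    have hc : ζ ≠ 0 := by rintro rfl; norm_num at hζ
    let g : Equiv.Perm ℂ :=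
      { toFun := fun x => ζ * x + l
        invFun := fun x => ζ⁻¹ * (x - l)
        left_inv := fun x => by field_simp; ring
        right_inv := fun x => by field_simp; ring }
    exact ⟨⟨g, ζ, hζ, l, hl, fun _ => rfl⟩, rfl⟩

theorem p_mul_add {ζ l : ℂ} (hζ : ζ ^ 3 = 1) (hl : l ∈ zTau) (z : ℂ) : p (ζ * z + l) = p z :=
  ((p_eq_p_iff _ _).2 ⟨ζ, hζ, l, hl, rfl⟩).symm

theorem p_add {l : ℂ} (hl : l ∈ zTau) (z : ℂ) : p (z + l) = p z := by
  simpa using p_mul_add (one_pow 3) hl z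

theorem mem_zTau_of_p_eq_p_zero {l : ℂ} (h : p 0 = p l) : l ∈ zTau := by
  obtain ⟨ζ, -, l', hl', rfl⟩ := (p_eq_p_iff _ _).1 h
  simpa using hl'

theorem p_surjective : Function.Surjective p := by
  intro a
  induction a using Quotient.inductionOn' with
  | h e =>
    induction e using QuotientAddGroup.induction_on with
    | H z => exact ⟨z, rfl⟩

/-- The closed parallelogram spanned by `1` and `τ` contains a fundamental domain of `ℤ[τ]`. -/
theorem exists_fundamental_representative (z : ℂ) :
    ∃ l ∈ zTau, ∃ s ∈ Icc (0 : ℝ) 1, ∃ t ∈ Icc (0 : ℝ) 1, z = (s + t * tau) + l := by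
  set t := z.im / tau.im with ht
  set s := z.re - t * tau.re with hs
  have hz : z = s + t * tau := by
    apply Complex.ext
    · simp [hs]
    · simp [ht, div_mul_cancel₀ _ tau_im_ne_zero]
  refine ⟨⌊s⌋ + ⌊t⌋ * tau, ⟨_, _, rfl⟩, Int.fract s, ⟨Int.fract_nonneg _, (Int.fract_lt_one _).le⟩,
    Int.fract t, ⟨Int.fract_nonneg _, (Int.fract_lt_one _).le⟩, ?_⟩
  have h1 : (s : ℂ) = ⌊s⌋ + (Int.fract s : ℝ) := by exact_mod_cast (Int.floor_add_fract s).symm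
  have h2 : (t : ℂ) = ⌊t⌋ + (Int.fract t : ℝ) := by exact_mod_cast (Int.floor_add_fract t).symm
  rw [hz]
  linear_combination h1 + tau * h2

/-- An entire function which is periodic with respect to `ℤ[τ]` is constant. -/
theorem exists_eq_const_of_periodic {h : ℂ → ℂ} (hd : Differentiable ℂ h)
    (hp : ∀ z, ∀ l ∈ zTau, h (z + l) = h z) : ∃ c, ∀ z, h z = c := by
  refine hd.exists_const_forall_eq_of_bounded ?_
  have hK : IsCompact ((fun q : ℝ × ℝ => h (q.1 + q.2 * tau)) '' (Icc 0 1 ×ˢ Icc 0 1)) := by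
    refine (isCompact_Icc.prod isCompact_Icc).image (hd.continuous.comp ?_)
    fun_prop
  refine hK.isBounded.subset ?_
  rintro _ ⟨z, rfl⟩
  obtain ⟨l, hl, s, hs, t, ht, rfl⟩ := exists_fundamental_representative z
  exact ⟨(s, t), ⟨hs, ht⟩, (hp _ l hl).symm⟩

/-! ### Holomorphic functions with the same image under `p` -/

/-- Two holomorphic functions on a connected open set which have the same image under `p` near one
point differ by a single deck transformation. -/
theorem exists_deck_of_eventually_p_eq {U : Set ℂ} (hU : IsOpen U) (hc : IsPreconnected U)
    {f g : ℂ → ℂ} (hf : DifferentiableOn ℂ f U) (hg : DifferentiableOn ℂ g U) {z : ℂ} (hz : z ∈ U)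
    (h : ∀ᶠ w in 𝓝 z, p (f w) = p (g w)) :
    ∃ ζ : ℂ, ζ ^ 3 = 1 ∧ ∃ l ∈ zTau, EqOn g (fun w => ζ * f w + l) U := by
  obtain ⟨r, hr, hrU⟩ := Metric.nhds_basis_closedBall.mem_iff.1
    (inter_mem (hU.mem_nhds hz) h)
  let T : Set (ℂ × ℂ) := {ζ : ℂ | ζ ^ 3 = 1} ×ˢ (zTau : Set ℂ)
  have hT : T.Countable := countable_cubeRoots.prod countable_zTau
  let S : ℂ × ℂ → Set ℂ := fun t => {w ∈ closedBall z r | g w = t.1 * f w + t.2}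
  -- The countably many sets `S t` cover an uncountable ball, so one is infinite. It accumulates in
  -- the compact ball, and the identity theorem applies.
  obtain ⟨t, ht, hS⟩ : ∃ t ∈ T, (S t).Infinite := by
    by_contra hcon
    push Not at hcon
    have hcount : (⋃ t ∈ T, S t).Countable :=
      hT.biUnion fun t ht => (hcon t ht).countable
    obtain ⟨w, hw, hwr⟩ := (hcount.dense_compl ℂ).exists_dist_lt z hr
    have hwb : w ∈ closedBall z r := by
      rw [mem_closedBall, dist_comm]; exact hwr.le
    obtain ⟨ζ, hζ, l, hl, hgw⟩ := (p_eq_p_iff _ _).1 (hrU hwb).2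
    exact hw (mem_biUnion (show (ζ, l) ∈ T from ⟨hζ, hl⟩) ⟨hwb, hgw⟩)
  obtain ⟨x, hx, hacc⟩ := hS.exists_accPt_of_subset_isCompact (isCompact_closedBall z r)
    fun w hw => hw.1
  refine ⟨t.1, ht.1, t.2, ht.2, ?_⟩
  refine (hg.analyticOnNhd hU).eqOn_of_preconnected_of_frequently_eq
    (((hf.const_mul t.1).add_const t.2).analyticOnNhd hU) hc (hrU hx).1 ?_
  exact (accPt_iff_frequently_nhdsNE.1 hacc).mono fun w hw => hw.2

/-- A continuous function on `ℂ` which is differentiable off a countable set is entire. -/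
theorem differentiable_of_differentiableAt_off_countable {f : ℂ → ℂ} {s : Set ℂ}
    (hs : s.Countable) (hf : Continuous f) (hd : ∀ z ∉ s, DifferentiableAt ℂ f z) :
    Differentiable ℂ f := fun _ =>
  (Complex.hasFPowerSeriesOnBall_of_differentiable_off_countable (R := 1) hs hf.continuousOn
    (fun w hw => hd w hw.2) one_pos).analyticAt.differentiableAt

/-- A continuous function with the same image under `p` as a nonzero linear function differs
from it by a single deck transformation. -/
theorem exists_deck_of_p_eq_p_mul {f : ℂ → ℂ} (hf : Continuous f) {a : ℂ} (ha : a ≠ 0)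
    (h : ∀ z, p (a * z) = p (f z)) :
    ∃ ζ : ℂ, ζ ^ 3 = 1 ∧ ∃ l ∈ zTau, ∀ z, f z = ζ * (a * z) + l := by
  let R : Set ℂ := {ζ : ℂ | ζ ^ 3 = 1}
  -- The solutions of `ζ a z + l = ζ₀ a z + l₀`: only there can `f` switch between rotation parts.
  -- Pairs with `ζ = ζ₀` merely add the point `0`, as division by zero gives `0`.
  let s : Set ℂ := (fun q : (ℂ × ℂ) × (ℂ × ℂ) => (q.2.2 - q.2.1) / (a * (q.1.1 - q.1.2))) ''
    ((R ×ˢ R) ×ˢ ((zTau : Set ℂ) ×ˢ (zTau : Set ℂ)))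
  have hs : s.Countable :=
    ((countable_cubeRoots.prod countable_cubeRoots).prod
      (countable_zTau.prod countable_zTau)).image _
  have hd : Differentiable ℂ f := by
    refine differentiable_of_differentiableAt_off_countable hs hf fun z hz => ?_
    obtain ⟨ζ₀, hζ₀, l₀, hl₀, hz₀⟩ := (p_eq_p_iff _ _).1 (h z)
    -- Off `s` no other root serves at `z`, nor nearby because the lattice is closed.
    have hne : ∀ ζ ∈ R, ζ ≠ ζ₀ → ∀ᶠ w in 𝓝 z, f w - ζ * (a * w) ∉ zTau := by
      intro ζ hζ hζne
      have hcont : Continuous fun w => f w - ζ * (a * w) := by fun_prop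
      refine hcont.continuousAt.eventually (isClosed_zTau.isOpen_compl.mem_nhds ?_)
      intro hmem
      refine hz ⟨((ζ, ζ₀), (f z - ζ * (a * z), l₀)), ⟨⟨hζ, hζ₀⟩, hmem, hl₀⟩, ?_⟩
      have : ζ - ζ₀ ≠ 0 := sub_ne_zero.2 hζne
      field_simp
      rw [hz₀]
      ring
    have hall : ∀ᶠ w in 𝓝 z, ∀ ζ ∈ R, ζ ≠ ζ₀ → f w - ζ * (a * w) ∉ zTau := by
      have hfin : R.Finite := (Set.toFinite {1, tau, -tau - 1}).subset fun ζ hζ => by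
        simpa using eq_of_pow_three hζ
      refine (eventually_all_finite hfin).2 fun ζ hζ => ?_
      by_cases h' : ζ = ζ₀
      · exact Eventually.of_forall fun w hw => absurd h' hw
      · exact (hne ζ hζ h').mono fun w hw _ => hw
    -- Distinct lattice points are at distance at least `1`, so this freezes the translation part.
    have hclose : ∀ᶠ w in 𝓝 z, ‖f w - ζ₀ * (a * w) - l₀‖ < 1 := by
      have hcont : Continuous fun w => ‖f w - ζ₀ * (a * w) - l₀‖ := by fun_prop
      refine hcont.continuousAt.eventually_lt continuousAt_const ?_
      rw [hz₀]
      simp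
    have heq : f =ᶠ[𝓝 z] fun w => ζ₀ * (a * w) + l₀ := by
      filter_upwards [hall, hclose] with w hw hw'
      obtain ⟨ζ, hζ, l, hl, hwl⟩ := (p_eq_p_iff _ _).1 (h w)
      have hl' : f w - ζ * (a * w) = l := by rw [hwl]; ring
      have hζeq : ζ = ζ₀ := by
        by_contra hcon
        exact hw ζ hζ hcon (hl' ▸ hl)
      subst hζeq
      rw [hl'] at hw'
      have hll : l - l₀ = 0 := by
        by_contra hcon
        exact absurd hw' (not_lt.2 (one_le_norm_of_mem_zTau (zTau.sub_mem hl hl₀) hcon))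
      rw [hwl, sub_eq_zero.1 hll]
    exact DifferentiableAt.congr_of_eventuallyEq (by fun_prop) heq
  obtain ⟨ζ, hζ, l, hl, heq⟩ := exists_deck_of_eventually_p_eq isOpen_univ isPreconnected_univ
    (f := fun z => a * z) (by fun_prop) hd.differentiableOn (mem_univ 0) (Eventually.of_forall h)
  exact ⟨ζ, hζ, l, hl, fun z => heq (mem_univ z)⟩

/-! ### Local liftings -/

/-- `F` is a holomorphic lifting of `u` on `U`. -/
def IsHolomorphicLiftOn (u : P333 → P333) (F : ℂ → ℂ) (U : Set ℂ) : Prop :=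
  DifferentiableOn ℂ F U ∧ ∀ w ∈ U, p (F w) = u (p w)

theorem IsHolomorphicLiftOn.mono {u : P333 → P333} {F : ℂ → ℂ} {U V : Set ℂ}
    (hF : IsHolomorphicLiftOn u F U) (h : V ⊆ U) : IsHolomorphicLiftOn u F V :=
  ⟨hF.1.mono h, fun w hw => hF.2 w (h hw)⟩

theorem IsHolomorphicOrbiMap.exists_lift {u : P333 → P333} (hu : IsHolomorphicOrbiMap u) (z : ℂ) :
    ∃ F : ℂ → ℂ, ∃ r > 0, IsHolomorphicLiftOn u F (ball z r) := by
  obtain ⟨x, y, hx, -, ⟨L⟩⟩ := hu.2 (p z)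
  obtain ⟨ζ, hζ, l, hl, hxz⟩ := (p_eq_p_iff _ _).1 hx.symm
  have hcont : Continuous fun w => ζ * w + l := by fun_prop
  have hmem : (fun w => ζ * w + l) ⁻¹' L.dom.V ∈ 𝓝 z :=
    hcont.continuousAt.preimage_mem_nhds (L.dom.isOpen.mem_nhds (by
      rw [← hxz]; exact L.dom.mem))
  obtain ⟨r, hr, hsub⟩ := Metric.mem_nhds_iff.1 hmem
  refine ⟨fun w => L.toFun (ζ * w + l), r, hr, ?_, fun w hw => ?_⟩
  · exact L.holomorphic.comp (g := L.toFun) (f := fun w => ζ * w + l) (by fun_prop) hsub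
  · rw [L.lifts _ (hsub hw), p_mul_add hζ hl]

/-- The cube of the derivative does not depend on the choice of the local lifting. -/
theorem IsHolomorphicLiftOn.deriv_pow_three_eq {u : P333 → P333} {F G : ℂ → ℂ}
    {x : ℂ} {U V : Set ℂ} (hF : IsHolomorphicLiftOn u F U) (hG : IsHolomorphicLiftOn u G V)
    (hU : U ∈ 𝓝 x) (hV : V ∈ 𝓝 x) : deriv F x ^ 3 = deriv G x ^ 3 := by
  obtain ⟨ε, hε, hsub⟩ := Metric.mem_nhds_iff.1 (inter_mem hU hV)
  have hF' := hF.mono fun w hw => (hsub hw).1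
  have hG' := hG.mono fun w hw => (hsub hw).2
  have hx : x ∈ ball x ε := mem_ball_self hε
  obtain ⟨ζ, hζ, l, -, heq⟩ := exists_deck_of_eventually_p_eq isOpen_ball
    (convex_ball x ε).isPreconnected hF'.1 hG'.1 hx (by
      filter_upwards [isOpen_ball.mem_nhds hx] with w hw
      rw [hF'.2 w hw, hG'.2 w hw])
  have hd : deriv G x = ζ * deriv F x := by
    rw [(heq.eventuallyEq_of_mem (isOpen_ball.mem_nhds hx)).deriv_eq, deriv_add_const,
      deriv_const_mul _ (hF'.1.differentiableAt (isOpen_ball.mem_nhds hx))]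
  rw [hd, mul_pow, hζ, one_mul]

/-- All local liftings of a holomorphic map of orbifolds have a derivative with the same constant
third power. -/
theorem IsHolomorphicOrbiMap.exists_deriv_pow_three_eq {u : P333 → P333}
    (hu : IsHolomorphicOrbiMap u) :
    ∃ c : ℂ, ∀ F U, IsHolomorphicLiftOn u F U → ∀ x, U ∈ 𝓝 x → deriv F x ^ 3 = c := by
  choose F r hr hF using hu.exists_lift
  have key : ∀ G U, IsHolomorphicLiftOn u G U → ∀ x, U ∈ 𝓝 x →
      deriv G x ^ 3 = deriv (F x) x ^ 3 := fun G U hG x hU =>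
    hG.deriv_pow_three_eq (hF x) hU (ball_mem_nhds x (hr x))
  -- The chosen lift varies with the point, but by `key` the single lift `F z` computes the function
  -- near `z`.
  obtain ⟨c, hc⟩ := exists_eq_const_of_periodic (h := fun z => deriv (F z) z ^ 3) (fun z => by
      have hd : DifferentiableAt ℂ (fun w => deriv (F z) w ^ 3) z :=
        (((hF z).1.deriv isOpen_ball).differentiableAt (ball_mem_nhds z (hr z))).pow 3
      refine hd.congr_of_eventuallyEq ?_
      filter_upwards [ball_mem_nhds z (hr z)] with w hw
      exact (key _ _ (hF z) w (isOpen_ball.mem_nhds hw)).symm) (fun z l hl => by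
      have hG : IsHolomorphicLiftOn u (fun w => F (z + l) (w + l)) (ball z (r (z + l))) := by
        have hsub : MapsTo (fun w => w + l) (ball z (r (z + l))) (ball (z + l) (r (z + l))) := by
          intro w hw
          simpa using hw
        refine ⟨(hF (z + l)).1.comp (g := F (z + l)) (f := fun w => w + l) (by fun_prop) hsub,
          fun w hw => ?_⟩
        rw [(hF (z + l)).2 _ (hsub hw), p_add hl]
      have := key _ _ hG z (ball_mem_nhds z (hr _))
      rwa [deriv_comp_add_const] at this)
  exact ⟨c, fun G U hG x hU => (key G U hG x hU).trans (hc x)⟩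

/-- A function on a ball whose derivative has constant third power is affine. -/
theorem exists_eq_affine_of_deriv_pow_three {F : ℂ → ℂ} {x c : ℂ} {r : ℝ}
    (hF : DifferentiableOn ℂ F (ball x r)) (hc : ∀ w ∈ ball x r, deriv F w ^ 3 = c) :
    ∃ a b : ℂ, ∀ w ∈ ball x r, F w = a * w + b := by
  have hpre : IsPreconnected (ball x r) := (convex_ball x r).isPreconnected
  have hF' := hF.deriv isOpen_ball
  have hzero : EqOn (deriv (deriv F)) 0 (ball x r) := by
    intro w hw
    have hw' := isOpen_ball.mem_nhds hw
    have hd := hF'.differentiableAt hw'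
    have h1 : deriv (fun v => deriv F v ^ 3) w = 0 := by
      have : (fun v => deriv F v ^ 3) =ᶠ[𝓝 w] fun _ => c := by
        filter_upwards [hw'] with v hv using hc v hv
      rw [this.deriv_eq, deriv_const]
    replace h1 := (hd.hasDerivAt.pow 3).deriv.symm.trans h1
    simp only [Pi.zero_apply]
    -- `3 F'² F'' = 0` yields `F'' = 0` only where `F' ≠ 0`; for `c = 0`, `F'` itself vanishes on
    -- the ball.
    by_cases h0 : c = 0
    · have : deriv F =ᶠ[𝓝 w] fun _ => 0 := by
        filter_upwards [hw'] with v hv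
        exact pow_eq_zero_iff (three_ne_zero) |>.1 ((hc v hv).trans h0)
      rw [this.deriv_eq, deriv_const]
    · have hne : deriv F w ≠ 0 := by
        intro h
        exact h0 (by rw [← hc w hw, h]; norm_num)
      simpa [hne] using h1
  obtain ⟨a, ha⟩ := isOpen_ball.exists_is_const_of_deriv_eq_zero hpre hF' hzero
  obtain ⟨b, hb⟩ := isOpen_ball.exists_eq_add_of_deriv_eq hpre hF
    (g := fun w => a * w) (by fun_prop) (fun w hw => by
      rw [ha w hw]
      simp)
  exact ⟨a, b, hb⟩

/-- A holomorphic map of orbifolds has an affine lifting to the universal covers. -/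
theorem IsHolomorphicOrbiMap.exists_affine_lift {u : P333 → P333} (hu : IsHolomorphicOrbiMap u) :
    ∃ a b : ℂ, ∀ z, p (a * z + b) = u (p z) := by
  obtain ⟨c, hc⟩ := hu.exists_deriv_pow_three_eq
  obtain ⟨F, r, hr, hF⟩ := hu.exists_lift 0
  obtain ⟨a, b, hab⟩ := exists_eq_affine_of_deriv_pow_three hF.1
    fun w hw => hc _ _ hF w (isOpen_ball.mem_nhds hw)
  refine ⟨a, b, ?_⟩
  -- Asking for equality near `z` makes `S` open. It is closed because agreement near one point of a
  -- ball carrying a lift spreads over that ball.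
  let S : Set ℂ := {z | ∀ᶠ w in 𝓝 z, p (a * w + b) = u (p w)}
  have hopen : IsOpen S := isOpen_setOfPred_eventually_nhds
  have hclosed : IsClosed S := by
    refine isClosed_of_closure_subset fun z hz => ?_
    obtain ⟨G, s, hs, hG⟩ := hu.exists_lift z
    obtain ⟨x, hxb, hxS⟩ := mem_closure_iff_nhds.1 hz _ (ball_mem_nhds z hs)
    obtain ⟨ζ, hζ, l, hl, heq⟩ := exists_deck_of_eventually_p_eq isOpen_ball
      (convex_ball z s).isPreconnected (f := fun w => a * w + b) (by fun_prop) hG.1 hxb (by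
        filter_upwards [hxS, isOpen_ball.mem_nhds hxb] with w hw hw'
        rw [hw, hG.2 w hw'])
    filter_upwards [ball_mem_nhds z hs] with w hw
    rw [← hG.2 w hw, heq hw, p_mul_add hζ hl]
  have h0 : (0 : ℂ) ∈ S := by
    filter_upwards [ball_mem_nhds 0 hr] with w hw
    rw [← hab w hw, hF.2 w hw]
  have huniv : S = univ := IsClopen.eq_univ ⟨hclosed, hopen⟩ ⟨0, h0⟩
  intro z
  exact (show z ∈ S from huniv ▸ mem_univ z).self_of_nhds

end OrbiSphere

theorem proposition5p1 (u : OrbiSphere.P333 → OrbiSphere.P333) (j k : Fin 3)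
    (hu : OrbiSphere.ContributesTo u ![0, j, k])
    (hne : ¬ ∃ c : OrbiSphere.P333, ∀ a, u a = c) :
    (∃ f : ℂ → ℂ, OrbiSphere.IsLifting u f ∧ f 0 = 0) ∧
      ∀ f : ℂ → ℂ, OrbiSphere.IsLifting u f → f 0 = 0 →
        ∃ l ∈ OrbiSphere.zTau, ∀ z : ℂ, f z = l * z := by
  open OrbiSphere in
  obtain ⟨a, b, hab⟩ := hu.1.exists_affine_lift
  have hu0 : u (p 0) = p 0 := by
    obtain ⟨-, -, -, -, h, -⟩ := hu.2 0
    simpa [conePoint, coneLift] using h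
  have hb : b ∈ zTau := mem_zTau_of_p_eq_p_zero (by rw [← hu0, ← hab]; simp)
  have hlin : ∀ z, p (a * z) = u (p z) := fun z => by rw [← hab z, p_add hb]
  have ha : a ≠ 0 := by
    rintro rfl
    refine hne ⟨p 0, fun x => ?_⟩
    obtain ⟨z, rfl⟩ := p_surjective x
    rw [← hlin z, zero_mul]
  have h1 : (1 : ℂ) ∈ zTau := ⟨1, 0, by simp⟩
  have haz : a ∈ zTau := mem_zTau_of_p_eq_p_zero (by
    rw [← mul_one a, hlin 1, ← zero_add (1 : ℂ), p_add h1, hu0])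
  refine ⟨⟨fun z => a * z, ⟨by fun_prop, hlin⟩, by simp⟩, fun f hf hf0 => ?_⟩
  obtain ⟨ζ, hζ, l, hl, hfl⟩ := exists_deck_of_p_eq_p_mul hf.1 ha
    fun z => (hlin z).trans (hf.2 z).symm
  have hl0 : l = 0 := by simpa [hf0] using (hfl 0).symm
  exact ⟨ζ * a, mul_mem_of_pow_three hζ haz, fun z => by rw [hfl z, hl0]; ring⟩
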